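/- **Theorem (Yao's XOR-Lemma).** A circuit is a Boolean circuit with one output over the basis of fan-in-two AND and OR, NOT and the constants $0,1$; its size is the number of its nodes (the input nodes it reads, the constants and the gates), so every circuit has size at least $1$. There is a real polynomial $p$ in three variables, with $p(n,k,1/\epsilon)>0$ for all integers $n,k\ge 0$ and all real $\epsilon>0$, such that the following holds for all integers $n,k,s\ge 0$, every predicate $P:\{0,1\}^n\to\{0,1\}$, and all real numbers $\delta'$ and $\epsilon'>0$. Suppose that every circuit $Q$ with $n$ input bits and of size at most $s$ satisfies $$\Pr_{x\leftarrow\{0,1\}^n}[Q(x)=P(x)]<1-\frac{\delta'}{2}.$$ Then every circuit $C$ with $kn$ input bits and of size at most $s/p(n,k,1/\epsilon')$ satisfies $$\Pr_{x_1,\dots,x_k\leftarrow\{0,1\}^n}[C(x_1,\dots,x_k)=P(x_1)\oplus\dots\oplus P(x_k)]\le \frac12+(1-\delta')^k+\epsilon',$$ where $x$, respectively $x_1,\dots,x_k$, are chosen uniformly and independently. -/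

import Mathlib

/-- A node of a Boolean circuit with input variables indexed by `ι`, when `m` nodes precede it
in topological order: an input, a constant, a negation, or a fan-in-two AND / OR whose arguments
are earlier nodes. -/
inductive CircuitNode (ι : Type) (m : ℕ) : Type where
  | input (i : ι) : CircuitNode ι m
  | const (b : Bool) : CircuitNode ι m
  | neg (a : Fin m) : CircuitNode ι m
  | and (a b : Fin m) : CircuitNode ι m
  | or (a b : Fin m) : CircuitNode ι m

/-- The value of a node, given the input assignment `x` and the values `v` of the earlier nodes. -/
def CircuitNode.value {ι : Type} {m : ℕ} (g : CircuitNode ι m) (x : ι → Bool)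
    (v : Fin m → Bool) : Bool :=
  match g with
  | .input i => x i
  | .const b => b
  | .neg a => !(v a)
  | .and a b => v a && v b
  | .or a b => v a || v b

/-- A topologically ordered list of `m` circuit nodes. A node may be used by any number of
later nodes (unbounded fan-out). -/
inductive NodeList (ι : Type) : ℕ → Type where
  | nil : NodeList ι 0
  | snoc {m : ℕ} (G : NodeList ι m) (g : CircuitNode ι m) : NodeList ι (m + 1)

/-- The values of all nodes on the input assignment `x`. -/
def NodeList.values {ι : Type} : {m : ℕ} → NodeList ι m → (ι → Bool) → Fin m → Bool
  | _, .nil, _ => fun j => j.elim0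
  | _, .snoc G g, x => Fin.snoc (α := fun _ => Bool) (G.values x) (g.value x (G.values x))

/-- A Boolean circuit with input variables indexed by `ι` and one output. Its size is the number
of its nodes (inputs that it reads, constants and gates). -/
structure BoolCircuit (ι : Type) : Type where
  size : ℕ
  nodes : NodeList ι size
  out : Fin size

/-- The output bit of a circuit on the input assignment `x`. -/
def BoolCircuit.eval {ι : Type} (C : BoolCircuit ι) (x : ι → Bool) : Bool :=
  C.nodes.values x C.out

/-- The probability of the event `E` under the uniform distribution on the finite type `Ω`. -/
noncomputable def uniformProb (Ω : Type) [Fintype Ω] (E : Ω → Prop) [DecidablePred E] : ℝ :=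
  ((Finset.univ.filter E).card : ℝ) / (Fintype.card Ω : ℝ)

/-- The exclusive or `b 0 ⊕ ⋯ ⊕ b (k - 1)`. -/
def xorBits {k : ℕ} (b : Fin k → Bool) : Bool :=
  (List.ofFn b).foldr Bool.xor false

/-! In signs, the hypothesis says that small circuits have correlation at most `c = 1 - δ` with `P`.
Levin's isolation lemma (`isolation`) adds one block at a time. Averaging `C x y` against the sign
of the other blocks' parity `R y` gives a function `T x`. Hardwiring `x` is free, so `|T| ≤ d` by
induction, and the correlation sought is the mean of `T` against `P`. About `1 / η ^ 2` fixed
samples `y` approximate `T` within `η` in mean (`exists_list_sum_abs_sub_le`). The estimate clamped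
to `[-d, d]` is monotone in the number of agreements, hence `d` times an average of signed
thresholds (`abs_sum_mul_monotone_le`). Each threshold is a small circuit
(`CircuitComputes.thresholds`), so the correlation is at most `c * d + η`. Iterating gives `c ^ k +
k * η`. -/

open Finset

/-! ### Circuit constructions: hardwiring and threshold counting -/

section Circuits

variable {ι κ : Type}

/-- Some circuit with at most `N` nodes computes every function of the family `F`. -/
def CircuitComputes (N : ℕ) (F : Set ((ι → Bool) → Bool)) : Prop :=
  ∃ M ≤ N, ∃ G : NodeList ι M, ∀ f ∈ F, ∃ j, ∀ x, G.values x j = f x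

namespace CircuitComputes

variable {N : ℕ} {F : Set ((ι → Bool) → Bool)}

theorem mono (h : CircuitComputes N F) {N' : ℕ} {F' : Set ((ι → Bool) → Bool)} (hN : N ≤ N')
    (hF : F' ⊆ F) : CircuitComputes N' F' := by
  obtain ⟨M, hM, G, hG⟩ := h
  exact ⟨M, hM.trans hN, G, fun f hf => hG f (hF hf)⟩

theorem empty : CircuitComputes 0 (∅ : Set ((ι → Bool) → Bool)) :=
  ⟨0, le_rfl, .nil, by simp⟩

theorem snoc {M : ℕ} (hM : M ≤ N) (G : NodeList ι M)
    (hG : ∀ f ∈ F, ∃ j, ∀ x, G.values x j = f x) (g : CircuitNode ι M) {f : (ι → Bool) → Bool}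
    (hg : ∀ x, g.value x (G.values x) = f x) : CircuitComputes (N + 1) (insert f F) := by
  refine ⟨M + 1, by omega, .snoc G g, ?_⟩
  rintro f' (rfl | hf')
  · exact ⟨Fin.last M, fun x => by simp [NodeList.values, hg]⟩
  · obtain ⟨j, hj⟩ := hG f' hf'
    exact ⟨j.castSucc, fun x => by simp [NodeList.values, hj]⟩

theorem input (h : CircuitComputes N F) (i : ι) :
    CircuitComputes (N + 1) (insert (fun x => x i) F) := by
  obtain ⟨M, hM, G, hG⟩ := h
  exact snoc hM G hG (.input i) fun x => rfl

theorem const (h : CircuitComputes N F) (b : Bool) :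
    CircuitComputes (N + 1) (insert (fun _ => b) F) := by
  obtain ⟨M, hM, G, hG⟩ := h
  exact snoc hM G hG (.const b) fun x => rfl

theorem neg (h : CircuitComputes N F) {f : (ι → Bool) → Bool} (hf : f ∈ F) :
    CircuitComputes (N + 1) (insert (fun x => !(f x)) F) := by
  obtain ⟨M, hM, G, hG⟩ := h
  obtain ⟨j, hj⟩ := hG f hf
  exact snoc hM G hG (.neg j) fun x => by simp [CircuitNode.value, hj]

theorem and (h : CircuitComputes N F) {f g : (ι → Bool) → Bool} (hf : f ∈ F) (hg : g ∈ F) :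
    CircuitComputes (N + 1) (insert (fun x => f x && g x) F) := by
  obtain ⟨M, hM, G, hG⟩ := h
  obtain ⟨j, hj⟩ := hG f hf
  obtain ⟨i, hi⟩ := hG g hg
  exact snoc hM G hG (.and j i) fun x => by simp [CircuitNode.value, hj, hi]

theorem or (h : CircuitComputes N F) {f g : (ι → Bool) → Bool} (hf : f ∈ F) (hg : g ∈ F) :
    CircuitComputes (N + 1) (insert (fun x => f x || g x) F) := by
  obtain ⟨M, hM, G, hG⟩ := h
  obtain ⟨j, hj⟩ := hG f hf
  obtain ⟨i, hi⟩ := hG g hg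
  exact snoc hM G hG (.or j i) fun x => by simp [CircuitNode.value, hj, hi]

theorem exists_circuit {f : (ι → Bool) → Bool} (h : CircuitComputes N {f}) :
    ∃ Q : BoolCircuit ι, Q.size ≤ N ∧ ∀ x, Q.eval x = f x := by
  obtain ⟨M, hM, G, hG⟩ := h
  obtain ⟨j, hj⟩ := hG f rfl
  exact ⟨⟨M, G, j⟩, hM, hj⟩

/-- Substituting input variables and constants for the inputs of a circuit does not increase
its size. -/
theorem substNodes (ρ : κ → ι ⊕ Bool) (h : CircuitComputes N F) {M : ℕ} (H : NodeList κ M) :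
    CircuitComputes (N + M)
      (F ∪ Set.range fun j (x : ι → Bool) => H.values (fun a => Sum.elim x id (ρ a)) j) := by
  induction H with
  | nil => exact h.mono le_rfl (by rintro f (hf | ⟨j, -⟩); exacts [hf, j.elim0])
  | @snoc M H g ih =>
    have key : CircuitComputes (N + M + 1) (insert
        (fun x : ι → Bool => g.value (fun a => Sum.elim x id (ρ a))
          (H.values fun a => Sum.elim x id (ρ a)))
        (F ∪ Set.range fun j (x : ι → Bool) => H.values (fun a => Sum.elim x id (ρ a)) j)) := by
      cases g with
      | input a =>
        cases hρ : ρ a with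
        | inl i => simpa [CircuitNode.value, hρ] using ih.input i
        | inr b => simpa [CircuitNode.value, hρ] using ih.const b
      | const b => exact ih.const b
      | neg a => exact ih.neg (Or.inr ⟨a, rfl⟩)
      | and a b => exact ih.and (Or.inr ⟨a, rfl⟩) (Or.inr ⟨b, rfl⟩)
      | or a b => exact ih.or (Or.inr ⟨a, rfl⟩) (Or.inr ⟨b, rfl⟩)
    refine key.mono le_rfl ?_
    rintro f (hf | ⟨j, rfl⟩)
    · exact Or.inr (Or.inl hf)
    · refine Fin.lastCases ?_ (fun i => ?_) j
      · exact Or.inl (by funext x; simp [NodeList.values])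
      · exact Or.inr (Or.inr ⟨i, by funext x; simp [NodeList.values]⟩)

theorem substCircuit (h : CircuitComputes N F) (C : BoolCircuit κ) (ρ : κ → ι ⊕ Bool) :
    CircuitComputes (N + C.size)
      (insert (fun x => C.eval fun a => Sum.elim x id (ρ a)) F) :=
  (h.substNodes ρ C.nodes).mono le_rfl (by
    rintro f (rfl | hf)
    exacts [Or.inr ⟨C.out, rfl⟩, Or.inl hf])

/-- Counting the true values among the functions `b y`, `y ∈ l`, and comparing the count with
all thresholds up to `m`. -/
theorem thresholds {Y : Type} {S : ℕ} {b : Y → (ι → Bool) → Bool}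
    (hb : ∀ y (N : ℕ) (F : Set ((ι → Bool) → Bool)), CircuitComputes N F →
      CircuitComputes (N + S) (insert (b y) F)) (m : ℕ) (l : List Y) :
    CircuitComputes (2 + l.length * (S + 2 * m))
      ((fun j x => decide (j ≤ l.countP fun y => b y x)) '' Set.Iic m) := by
  induction l with
  | nil =>
    refine ((empty.const true).const false).mono (by simp) ?_
    rintro _ ⟨j, -, rfl⟩
    rcases Nat.eq_zero_or_pos j with rfl | hj
    · exact Or.inr (Or.inl (by simp))
    · exact Or.inl (by funext x; simp; omega)
  | cons y l ih =>
    have h1 := hb y _ _ ih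
    -- A new bit makes the count reach `r + 1` iff the old count did, or it reached `r` and the bit
    -- is set: two gates per threshold. Threshold 0 is always true and costs nothing.
    have step : ∀ r ≤ m, CircuitComputes (2 + l.length * (S + 2 * m) + S + 2 * r)
        (insert (b y) ((fun j x => decide (j ≤ l.countP fun y => b y x)) '' Set.Iic m) ∪
          (fun j x => decide (j ≤ (y :: l).countP fun y => b y x)) '' Set.Iic r) := by
      intro r
      induction r with
      | zero =>
        intro _
        refine h1.mono le_rfl ?_
        rintro f (hf | ⟨j, hj, rfl⟩)
        · exact hf
        · obtain rfl : j = 0 := by simpa using hj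
          exact Or.inr ⟨0, by simp, by simp⟩
      | succ r ihr =>
        intro hr
        have h2 := ihr (by omega)
        have h3 := h2.and (f := fun x => decide (r ≤ l.countP fun y => b y x)) (g := b y)
          (Or.inl (Or.inr ⟨r, by simp; omega, rfl⟩)) (Or.inl (Or.inl rfl))
        have h4 := h3.or (g := fun x => decide (r + 1 ≤ l.countP fun y => b y x))
          (Set.mem_insert _ _) (Or.inr (Or.inl (Or.inr ⟨r + 1, by simpa using hr, rfl⟩)))
        refine h4.mono (by omega) ?_
        rintro f (hf | ⟨j, hj, rfl⟩)
        · exact Or.inr (Or.inr (Or.inl hf))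
        · rcases Nat.lt_or_ge r j with hj' | hj'
          · obtain rfl : j = r + 1 := le_antisymm hj hj'
            refine Or.inl ?_
            funext x
            rw [Bool.eq_iff_iff]
            by_cases hy : b y x = true
            · simp [hy]; omega
            · simp [hy]
          · exact Or.inr (Or.inr (Or.inr ⟨j, hj', rfl⟩))
    refine (step m le_rfl).mono (by rw [List.length_cons]; ring_nf; omega)
      Set.subset_union_right

end CircuitComputes

end Circuits

/-! ### Probabilities as correlations of signs -/

section Signs

/-- The sign `(-1)^b` of a bit. -/
def bitSign (b : Bool) : ℝ := if b then -1 else 1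

theorem bitSign_xor (a b : Bool) : bitSign (a ^^ b) = bitSign a * bitSign b := by
  cases a <;> cases b <;> simp [bitSign]

theorem bitSign_not (a : Bool) : bitSign (!a) = -bitSign a := by
  cases a <;> simp [bitSign]

theorem abs_bitSign (a : Bool) : |bitSign a| = 1 := by
  cases a <;> simp [bitSign]

theorem bitSign_mul_bitSign (a b : Bool) :
    bitSign a * bitSign b = 2 * (if a = b then 1 else 0) - 1 := by
  cases a <;> cases b <;> norm_num [bitSign]

theorem uniformProb_eq_eq {Ω : Type} [Fintype Ω] [Nonempty Ω] (f g : Ω → Bool) :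
    uniformProb Ω (fun x => f x = g x) =
      1 / 2 + (∑ x, bitSign (f x) * bitSign (g x)) / (2 * Fintype.card Ω) := by
  have h0 : (Fintype.card Ω : ℝ) ≠ 0 := by positivity
  have h : ∑ x, bitSign (f x) * bitSign (g x) =
      2 * ((univ.filter fun x => f x = g x).card : ℝ) - Fintype.card Ω := by
    simp only [bitSign_mul_bitSign, sum_sub_distrib, ← mul_sum, sum_boole]
    simp
  rw [h, uniformProb]
  field_simp
  ring

end Signs

/-! ### Sampling and threshold decomposition -/

section Sampling

variable {X Y : Type} [Fintype X] [Fintype Y] [Nonempty Y]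

/-- Sampling with a second-moment bound: some list of `m` points makes all centred sums small on
average. -/
theorem exists_list_sum_sq_le (g : X → Y → ℝ) (h0 : ∀ x, ∑ y, g x y = 0)
    (h1 : ∀ x, ∑ y, g x y ^ 2 ≤ Fintype.card Y) (m : ℕ) :
    ∃ l : List Y, l.length = m ∧ ∑ x, (l.map (g x)).sum ^ 2 ≤ m * Fintype.card X := by
  induction m with
  | zero => exact ⟨[], rfl, by simp⟩
  | succ m ih =>
    obtain ⟨l, hl, hs⟩ := ih
    obtain ⟨y, -, hy⟩ : ∃ y ∈ (univ : Finset Y),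
        ∑ x, (g x y + (l.map (g x)).sum) ^ 2 ≤ (m + 1) * Fintype.card X := by
      -- Average over the new point: the cross term vanishes because `g x` is centred.
      refine exists_le_of_sum_le univ_nonempty ?_
      rw [sum_comm]
      calc ∑ x, ∑ y, (g x y + (l.map (g x)).sum) ^ 2
          ≤ ∑ x, (Fintype.card Y : ℝ) * (1 + (l.map (g x)).sum ^ 2) := by
            refine sum_le_sum fun x _ => ?_
            have : ∑ y, (g x y + (l.map (g x)).sum) ^ 2 =
                ∑ y, g x y ^ 2 + 2 * (∑ y, g x y) * (l.map (g x)).sum +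
                  Fintype.card Y * (l.map (g x)).sum ^ 2 := by
              simp only [add_sq, sum_add_distrib, mul_sum, sum_mul, sum_const, card_univ,
                nsmul_eq_mul]
            rw [this, h0]
            linarith [h1 x]
        _ ≤ ∑ y : Y, ((m : ℝ) + 1) * Fintype.card X := by
            rw [← mul_sum, sum_add_distrib]
            simp only [sum_const, card_univ, nsmul_eq_mul, mul_one]
            gcongr
            linarith
    exact ⟨y :: l, by simp [hl], by simpa using hy⟩

/-- Centring `h x` reduces this to the second-moment bound; Cauchy–Schwarz over `x` then turns mean
square into mean absolute error. -/
theorem exists_list_sum_abs_sub_le (h : X → Y → ℝ) (h1 : ∀ x y, |h x y| ≤ 1) {m : ℕ} {η : ℝ}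
    (hη : 0 ≤ η) (hm : 1 ≤ m * η ^ 2) :
    ∃ l : List Y, l.length = m ∧
      ∑ x, |(∑ y, h x y) / Fintype.card Y - (l.map (h x)).sum / m| ≤ η * Fintype.card X := by
  have hY : (0 : ℝ) < Fintype.card Y := by positivity
  have hm0 : (0 : ℝ) < m := by
    rcases Nat.eq_zero_or_pos m with rfl | h
    · norm_num at hm
    · exact_mod_cast h
  set T : X → ℝ := fun x => (∑ y, h x y) / Fintype.card Y with hT
  have hTY : ∀ x, ∑ y, h x y = Fintype.card Y * T x := fun x => by
    simp only [hT]; field_simp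
  obtain ⟨l, hl, hs⟩ := exists_list_sum_sq_le (fun x y => h x y - T x)
    (fun x => by simp [sum_sub_distrib, hTY])
    (fun x => by
      have : ∑ y, (h x y - T x) ^ 2 = ∑ y, h x y ^ 2 - Fintype.card Y * T x ^ 2 := by
        simp only [sub_sq, sum_add_distrib, sum_sub_distrib, ← sum_mul, ← mul_sum, hTY,
          sum_const, card_univ, nsmul_eq_mul]
        ring
      have h2 : ∑ y, h x y ^ 2 ≤ ∑ y : Y, (1 : ℝ) :=
        sum_le_sum fun y _ => (sq_le_one_iff_abs_le_one _).2 (h1 x y)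
      simp only [sum_const, card_univ, nsmul_eq_mul, mul_one] at h2
      have : 0 ≤ (Fintype.card Y : ℝ) * T x ^ 2 := by positivity
      linarith) m
  refine ⟨l, hl, ?_⟩
  have hsum : ∀ x, (l.map fun y => h x y - T x).sum = (l.map (h x)).sum - m * T x := fun x => by
    rw [← hl]
    clear hl hs
    induction l with
    | nil => simp
    | cons y l ih =>
      simp only [List.map_cons, List.sum_cons, List.length_cons, ih]
      push_cast
      ring
  simp only [hsum] at hs
  refine abs_le_of_sq_le_sq' ?_ (by positivity) |>.2
  have hcs := sq_sum_le_card_mul_sum_sq (s := univ)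
    (f := fun x => |T x - (l.map (h x)).sum / m|)
  simp only [sq_abs, card_univ] at hcs
  refine hcs.trans ?_
  have e : ∑ x, (T x - (l.map (h x)).sum / m) ^ 2 =
      (∑ x, ((l.map (h x)).sum - m * T x) ^ 2) / (m : ℝ) ^ 2 := by
    rw [sum_div]
    refine sum_congr rfl fun x _ => ?_
    field_simp
    ring
  have e2 : ∑ x, (T x - (l.map (h x)).sum / m) ^ 2 ≤ η ^ 2 * Fintype.card X := by
    rw [e, div_le_iff₀ (by positivity)]
    calc _ ≤ (m : ℝ) * Fintype.card X * 1 := by rw [mul_one]; exact hs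
      _ ≤ (m : ℝ) * Fintype.card X * (m * η ^ 2) := by gcongr
      _ = _ := by ring
  calc _ ≤ (Fintype.card X : ℝ) * (η ^ 2 * Fintype.card X) := by gcongr
    _ = _ := by ring

/-- A monotone function on `{0, …, m}` with values in `[-d, d]` is `d` times an average of
signed thresholds. -/
theorem abs_sum_mul_monotone_le (w : X → ℝ) (cnt : X → ℕ) {m : ℕ} (hcnt : ∀ x, cnt x ≤ m)
    {g : ℕ → ℝ} (hg : Monotone g) {d B : ℝ} (hd : ∀ j, |g j| ≤ d)
    (h0 : |∑ x, w x| ≤ B)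
    (hB : ∀ j ≤ m, |∑ x, w x * bitSign (decide (j ≤ cnt x))| ≤ B) :
    |∑ x, w x * g (cnt x)| ≤ d * B := by
  have hBn : 0 ≤ B := (abs_nonneg _).trans h0
  -- Summation by parts; the minus sign appears because `bitSign true = -1`.
  have key : ∀ x, 2 * g (cnt x) = g 0 + g m -
      ∑ j ∈ range m, (g (j + 1) - g j) * bitSign (decide (j + 1 ≤ cnt x)) := by
    intro x
    have e : ∀ j, (g (j + 1) - g j) * bitSign (decide (j + 1 ≤ cnt x)) =
        (g (j + 1) - g j) - 2 * (if j < cnt x then g (j + 1) - g j else 0) := by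
      intro j
      by_cases hj : j < cnt x
      · simp [bitSign, hj]; ring
      · simp [bitSign, hj]
    simp only [e, sum_sub_distrib, ← mul_sum, ← sum_filter]
    have hf : (range m).filter (fun j => j < cnt x) = range (cnt x) := by
      ext j
      have := hcnt x
      simp only [mem_filter, mem_range]
      omega
    have h3 := sum_range_sub g (cnt x)
    have h4 := sum_range_sub g m
    rw [sum_sub_distrib] at h3 h4
    rw [hf]
    linarith
  have e : 2 * ∑ x, w x * g (cnt x) = (g 0 + g m) * ∑ x, w x -
      ∑ j ∈ range m, (g (j + 1) - g j) * ∑ x, w x * bitSign (decide (j + 1 ≤ cnt x)) := by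
    simp only [mul_sum]
    rw [sum_comm, ← sum_sub_distrib]
    refine sum_congr rfl fun x _ => ?_
    rw [show 2 * (w x * g (cnt x)) = w x * (2 * g (cnt x)) by ring, key, mul_sub, mul_sum]
    congr 1
    · ring
    · exact sum_congr rfl fun j _ => by ring
  have e1 : |(g 0 + g m) * ∑ x, w x| ≤ |g 0 + g m| * B := by
    rw [abs_mul]; gcongr
  have e2 : |∑ j ∈ range m, (g (j + 1) - g j) *
      ∑ x, w x * bitSign (decide (j + 1 ≤ cnt x))| ≤ (g m - g 0) * B := by
    rw [← sum_range_sub g m, sum_mul]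
    refine (abs_sum_le_sum_abs _ _).trans (sum_le_sum fun j hj => ?_)
    have := hg (Nat.le_succ j)
    rw [abs_mul, abs_of_nonneg (by simpa using this)]
    exact mul_le_mul_of_nonneg_left (hB _ (by simpa using hj)) (by simpa using this)
  -- The total weight is `2 * max |g 0| |g m|`.
  have e3 : |g 0 + g m| + (g m - g 0) ≤ 2 * d := by
    have a := abs_le.1 (hd 0)
    have b := abs_le.1 (hd m)
    rcases abs_cases (g 0 + g m) with ⟨h, -⟩ | ⟨h, -⟩ <;> rw [h] <;> linarith
  have e4 : |2 * ∑ x, w x * g (cnt x)| ≤ 2 * d * B := by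
    rw [e]
    refine (abs_sub _ _).trans ((add_le_add e1 e2).trans ?_)
    rw [← add_mul]
    gcongr
  rw [abs_mul, abs_two] at e4
  linarith

end Sampling

/-! ### The isolation lemma and its iteration -/

section XorLemma

/-- Levin's isolation lemma: correlation bounds for two predicates multiply, up to `η`, for the
exclusive or of the predicates. -/
theorem isolation {n m S s : ℕ} {Y : Type} [Fintype Y] [Nonempty Y]
    {P : (Fin n → Bool) → Bool} {c : ℝ}
    (hP : ∀ f, CircuitComputes s {f} → |∑ x, bitSign (f x) * bitSign (P x)| ≤ c * 2 ^ n)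
    {R : Y → Bool} {C : (Fin n → Bool) → Y → Bool}
    (hC : ∀ y (N : ℕ) (F : Set ((Fin n → Bool) → Bool)), CircuitComputes N F →
      CircuitComputes (N + S) (insert (fun x => C x y) F))
    {d : ℝ} (hR : ∀ x, |∑ y, bitSign (C x y) * bitSign (R y)| ≤ d * Fintype.card Y)
    {η : ℝ} (hη : 0 ≤ η) (hm : 1 ≤ m * η ^ 2) (hs : 2 + m * (S + 1 + 2 * m) ≤ s) :
    |∑ x, ∑ y, bitSign (C x y) * (bitSign (P x) * bitSign (R y))| ≤
      (c * d + η) * (2 ^ n * Fintype.card Y) := by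
  have hY : (0 : ℝ) < Fintype.card Y := by positivity
  have hm0 : (0 : ℝ) < m := by
    rcases Nat.eq_zero_or_pos m with rfl | h
    · norm_num at hm
    · exact_mod_cast h
  set h : (Fin n → Bool) → Y → ℝ := fun x y => bitSign (C x y) * bitSign (R y) with hh
  obtain ⟨l, hl, hls⟩ := exists_list_sum_abs_sub_le h
    (fun x y => by simp [hh, abs_mul, abs_bitSign]) hη hm
  set T : (Fin n → Bool) → ℝ := fun x => (∑ y, h x y) / Fintype.card Y with hT
  have hTd : ∀ x, |T x| ≤ d := fun x => by
    simp only [hT]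
    rw [abs_div, abs_of_pos hY, div_le_iff₀ hY]
    exact hR x
  have hd : 0 ≤ d := (abs_nonneg _).trans (hTd fun _ => false)
  -- True exactly when `C x y` agrees with `R y`; the possible negation is the extra node in `S +
  -- 1`.
  set b : Y → (Fin n → Bool) → Bool := fun y x => C x y ^^ !(R y) with hb
  set cnt : (Fin n → Bool) → ℕ := fun x => l.countP fun y => b y x with hcnt
  have hcnt_le : ∀ x, cnt x ≤ m := fun x => hl ▸ List.countP_le_length
  have hsum : ∀ x, (l.map (h x)).sum = 2 * cnt x - m := by
    intro x
    rw [← hl]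
    simp only [hcnt]
    clear hl hls hcnt_le hcnt cnt
    induction l with
    | nil => simp
    | cons y l ih =>
      rw [List.map_cons, List.sum_cons, ih, List.countP_cons, List.length_cons]
      simp only [hh, hb]
      cases C x y <;> cases R y <;> simp [bitSign] <;> ring
  have hbS : ∀ y (N : ℕ) (F : Set ((Fin n → Bool) → Bool)), CircuitComputes N F →
      CircuitComputes (N + (S + 1)) (insert (b y) F) := by
    intro y N F hF
    have h1 := hC y N F hF
    cases hy : R y with
    | false =>
      refine (h1.neg (Set.mem_insert _ _)).mono le_rfl ?_
      simp only [hb, hy]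
      rintro f (rfl | hf)
      · exact Or.inl (by funext x; simp)
      · exact Or.inr (Or.inr hf)
    | true =>
      refine h1.mono (by omega) ?_
      simp [hb, hy]
  have hth := CircuitComputes.thresholds hbS m l
  rw [hl] at hth
  -- The empirical mean for `j` agreements, clamped. Clamping is 1-Lipschitz and fixes `T`, so it
  -- does not increase the sampling error.
  set g : ℕ → ℝ := fun j => max (-d) (min d ((2 * j - m) / m)) with hg
  have hgm : Monotone g := by
    intro i j hij
    have : (i : ℝ) ≤ j := by exact_mod_cast hij
    simp only [hg]
    gcongr
  have hgd : ∀ j, |g j| ≤ d := fun j =>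
    abs_le.2 ⟨le_max_left _ _, max_le (by linarith) (min_le_left _ _)⟩
  have hthr : ∀ j ≤ m, |∑ x, bitSign (P x) * bitSign (decide (j ≤ cnt x))| ≤ c * 2 ^ n := by
    intro j hj
    simp_rw [mul_comm (bitSign (P _))]
    exact hP _ (hth.mono hs (by rintro _ rfl; exact ⟨j, hj, rfl⟩))
  have hmain := abs_sum_mul_monotone_le (fun x => bitSign (P x)) cnt hcnt_le hgm hgd
    (by simpa [bitSign] using hthr 0 (Nat.zero_le _)) hthr
  have hdiff : |∑ x, bitSign (P x) * (T x - g (cnt x))| ≤ η * 2 ^ n := by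
    refine (abs_sum_le_sum_abs _ _).trans ((sum_le_sum fun x _ => ?_).trans
      (hls.trans_eq (by simp)))
    rw [abs_mul, abs_bitSign, one_mul, hsum]
    have hx := abs_le.1 (hTd x)
    have e : T x = max (-d) (min d (T x)) := by rw [min_eq_right hx.2, max_eq_right hx.1]
    simp only [hg]
    nth_rewrite 1 [e]
    refine (abs_max_sub_max_le_max _ _ _ _).trans (max_le (by simp) ?_)
    exact (abs_min_sub_min_le_max _ _ _ _).trans (max_le (by simp) le_rfl)
  have e : ∑ x, ∑ y, bitSign (C x y) * (bitSign (P x) * bitSign (R y)) =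
      Fintype.card Y * (∑ x, bitSign (P x) * (T x - g (cnt x)) +
        ∑ x, bitSign (P x) * g (cnt x)) := by
    rw [← sum_add_distrib, mul_sum]
    refine sum_congr rfl fun x _ => ?_
    rw [← mul_add, sub_add_cancel]
    simp only [hT]
    rw [mul_left_comm, mul_div_cancel₀ _ hY.ne', mul_sum]
    exact sum_congr rfl fun y _ => by simp only [hh]; ring
  rw [e, abs_mul, abs_of_pos hY]
  calc _ ≤ (Fintype.card Y : ℝ) * (η * 2 ^ n + d * (c * 2 ^ n)) := by
        gcongr
        exact (abs_add_le _ _).trans (add_le_add hdiff hmain)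
    _ = _ := by ring

theorem xorBits_cons {k : ℕ} (a : Bool) (b : Fin k → Bool) :
    xorBits (Fin.cons a b : Fin (k + 1) → Bool) = (a ^^ xorBits b) := by
  simp [xorBits, List.ofFn_succ]

/-- Peel off the first block by `isolation`. The same `S` and `m` serve at every level, since
hardwiring inputs never enlarges `C`. -/
theorem abs_sum_xorBits_le {n m S s : ℕ} {P : (Fin n → Bool) → Bool} {c : ℝ} (hc1 : c ≤ 1)
    (hP : ∀ f, CircuitComputes s {f} → |∑ x, bitSign (f x) * bitSign (P x)| ≤ c * 2 ^ n)
    {η : ℝ} (hη : 0 ≤ η) (hm : 1 ≤ m * η ^ 2) (hs : 2 + m * (S + 1 + 2 * m) ≤ s) (k : ℕ) :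
    ∀ C : BoolCircuit (Fin k × Fin n), C.size ≤ S →
      |∑ x : Fin k → Fin n → Bool,
        bitSign (C.eval fun ij => x ij.1 ij.2) * bitSign (xorBits fun i => P (x i))| ≤
        (c ^ k + k * η) * Fintype.card (Fin k → Fin n → Bool) := by
  induction k with
  | zero =>
    intro C _
    simp [abs_mul, abs_bitSign]
  | succ k ih =>
    intro C hC
    have hiso := isolation (Y := Fin k → Fin n → Bool) (S := S) hP
      (R := fun y => xorBits fun i => P (y i))
      (C := fun x y => C.eval fun ij => (Fin.cons x y : Fin (k + 1) → Fin n → Bool) ij.1 ij.2)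
      (fun y N F hF => by
        refine (hF.substCircuit C fun ij =>
          (Fin.cons Sum.inl fun i a => Sum.inr (y i a) :
            Fin (k + 1) → Fin n → Fin n ⊕ Bool) ij.1 ij.2).mono (by omega) ?_
        rintro f (rfl | hf)
        · refine Or.inl ?_
          funext x
          congr 1
          funext ⟨i, a⟩
          refine Fin.cases ?_ (fun i => ?_) i <;> simp
        · exact Or.inr hf)
      (d := c ^ k + k * η)
      (fun x => by
        obtain ⟨Q, hQ, hQe⟩ := ((CircuitComputes.empty.substCircuit C fun ij =>
          (Fin.cons (fun a => Sum.inr (x a)) (fun i a => Sum.inl (i, a)) :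
            Fin (k + 1) → Fin n → (Fin k × Fin n) ⊕ Bool) ij.1 ij.2).mono le_rfl
              (Set.singleton_subset_iff.2 (Set.mem_insert _ _))).exists_circuit
        refine le_of_eq_of_le ?_ (ih Q (by omega))
        congr 1
        refine sum_congr rfl fun y _ => ?_
        rw [hQe]
        congr 3
        funext ⟨i, a⟩
        refine Fin.cases ?_ (fun i => ?_) i <;> simp)
      hη hm hs
    rw [← (Fin.consEquiv fun _ => Fin n → Bool).sum_comp, Fintype.sum_prod_type]
    have hcard : (Fintype.card (Fin (k + 1) → Fin n → Bool) : ℝ) =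
        2 ^ n * Fintype.card (Fin k → Fin n → Bool) := by
      simp [pow_succ, mul_comm]
    have hx : ∀ (x : Fin n → Bool) (y : Fin k → Fin n → Bool),
        (xorBits fun i => P ((Fin.cons x y : Fin (k + 1) → Fin n → Bool) i)) =
          (P x ^^ xorBits fun i => P (y i)) := by
      intro x y
      rw [← xorBits_cons]
      congr 1
      funext i
      refine Fin.cases ?_ (fun i => ?_) i <;> simp
    simp only [Fin.consEquiv_apply, hx, bitSign_xor]
    rw [hcard]
    refine hiso.trans ?_
    have : c * (k * η) ≤ k * η := mul_le_of_le_one_left (by positivity) hc1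
    refine mul_le_mul_of_nonneg_right ?_ (by positivity)
    push_cast
    rw [mul_add, pow_succ']
    linarith

theorem mainTheorem5 :
    ∃ p : MvPolynomial (Fin 3) ℝ,
      (∀ (n k : ℕ) (ε : ℝ), 0 < ε →
        0 < MvPolynomial.eval ![(n : ℝ), (k : ℝ), 1 / ε] p) ∧
      ∀ (n k s : ℕ) (P : (Fin n → Bool) → Bool) (δ ε : ℝ), 0 < ε →
        (∀ Q : BoolCircuit (Fin n), Q.size ≤ s →
          uniformProb (Fin n → Bool) (fun x => Q.eval x = P x) < 1 - δ / 2) →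
        ∀ C : BoolCircuit (Fin k × Fin n),
          (C.size : ℝ) ≤ (s : ℝ) / MvPolynomial.eval ![(n : ℝ), (k : ℝ), 1 / ε] p →
          uniformProb (Fin k → Fin n → Bool)
              (fun x => C.eval (fun ij => x ij.1 ij.2) = xorBits (fun i => P (x i)))
            ≤ 1 / 2 + (1 - δ) ^ k + ε := by
  have hp : ∀ (n k : ℕ) (ε : ℝ), MvPolynomial.eval ![(n : ℝ), (k : ℝ), 1 / ε]
      (MvPolynomial.C 10 * (((MvPolynomial.X 1 + 1) * MvPolynomial.X 2) ^ 2 + 1) ^ 2) =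
        10 * (((k + 1) / ε) ^ 2 + 1) ^ 2 := by
    intro n k ε
    simp [div_eq_mul_inv]
  -- With `η = ε / (k + 1)`, sampling needs `m ≥ A = ((k + 1) / ε) ^ 2`. Since `⌈A⌉ ≤ A + 1`, the
  -- factor `10 * (A + 1) ^ 2` covers the threshold circuit.
  refine ⟨MvPolynomial.C 10 * (((MvPolynomial.X 1 + 1) * MvPolynomial.X 2) ^ 2 + 1) ^ 2,
    fun n k ε hε => by rw [hp]; positivity, ?_⟩
  intro n k s P δ ε hε hP C hC
  rw [hp] at hC
  set A : ℝ := ((k + 1) / ε) ^ 2 with hA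
  have hA0 : 0 < A := by positivity
  rw [le_div_iff₀ (by positivity)] at hC
  have hS : 1 ≤ C.size := C.out.pos
  set m : ℕ := ⌈A⌉₊ with hm
  have hmA : A ≤ m := Nat.le_ceil A
  have hmA' : (m : ℝ) ≤ A + 1 := (Nat.ceil_lt_add_one hA0.le).le
  have hm1 : 1 ≤ m := Nat.ceil_pos.2 hA0
  have hsize : 10 * (m ^ 2 * C.size) ≤ s := by
    have : (10 * (m ^ 2 * C.size) : ℝ) ≤ s :=
      calc (10 * (m ^ 2 * C.size) : ℝ) ≤ 10 * ((A + 1) ^ 2 * C.size) := by gcongr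
        _ ≤ s := by linarith
    exact_mod_cast this
  -- One node is reserved for negating the output, which makes the correlation bound two-sided.
  obtain ⟨t, rfl⟩ : ∃ t, s = t + 1 := by
    have : 0 < m ^ 2 * C.size := by positivity
    exact ⟨s - 1, by omega⟩
  have ht : 2 + m * (C.size + 1 + 2 * m) ≤ t := by
    have h1 : m * C.size ≤ m ^ 2 * C.size := Nat.mul_le_mul_right _ (Nat.le_self_pow two_ne_zero m)
    have h2 : m ^ 2 ≤ m ^ 2 * C.size := Nat.le_mul_of_pos_right _ hS
    have h3 : m ≤ m ^ 2 := Nat.le_self_pow two_ne_zero m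
    nlinarith
  have hcorr : ∀ f, CircuitComputes (t + 1) {f} →
      ∑ x, bitSign (f x) * bitSign (P x) ≤ (1 - δ) * 2 ^ n := by
    intro f hf
    obtain ⟨Q, hQ, hQe⟩ := hf.exists_circuit
    have := hP Q hQ
    simp only [hQe] at this
    rw [uniformProb_eq_eq] at this
    simp only [Fintype.card_pi, Fintype.card_bool, prod_const, card_univ, Fintype.card_fin,
      Nat.cast_pow, Nat.cast_ofNat] at this
    have h2 : (∑ x, bitSign (f x) * bitSign (P x)) / (2 * 2 ^ n) ≤ (1 - δ) / 2 := by linarith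
    rw [div_le_iff₀ (by positivity)] at h2
    linarith
  have habs : ∀ f, CircuitComputes t {f} →
      |∑ x, bitSign (f x) * bitSign (P x)| ≤ (1 - δ) * 2 ^ n := by
    intro f hf
    refine abs_le'.2 ⟨hcorr f (hf.mono (by omega) subset_rfl), ?_⟩
    have := hcorr _ ((hf.neg rfl).mono le_rfl (Set.singleton_subset_iff.2 (Set.mem_insert _ _)))
    simpa [bitSign_not] using this
  have hc0 : 0 ≤ 1 - δ := by
    have := (abs_nonneg _).trans (habs (fun _ => true)
      ((CircuitComputes.empty.const true).mono (by omega) (by simp)))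
    exact nonneg_of_mul_nonneg_left this (by positivity)
  rw [uniformProb_eq_eq]
  set N : ℝ := (Fintype.card (Fin k → Fin n → Bool) : ℝ) with hN
  have hN0 : 0 < N := by positivity
  -- For `δ ≤ 0` the claim is trivial; otherwise `c ≤ 1`, as the iteration requires.
  rcases le_or_gt δ 0 with hδ | hδ
  · have h1 : (1 : ℝ) ≤ (1 - δ) ^ k := one_le_pow₀ (by linarith)
    have h2 : ∑ x : Fin k → Fin n → Bool, bitSign (C.eval fun ij => x ij.1 ij.2) *
        bitSign (xorBits fun i => P (x i)) ≤ N := by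
      refine (sum_le_sum fun x _ => (le_abs_self _).trans_eq ?_).trans_eq
        (show ∑ x : Fin k → Fin n → Bool, (1 : ℝ) = N by simp [hN])
      rw [abs_mul, abs_bitSign, abs_bitSign, one_mul]
    have h3 := (div_le_iff₀ (by positivity : 0 < 2 * N)).2 (h2.trans_eq (by ring : N = 1 / 2 * (2 * N)))
    linarith
  · have hkey := (le_abs_self _).trans (abs_sum_xorBits_le (by linarith) habs
      (η := ε / (k + 1)) (by positivity) (m := m) (by
        calc (1 : ℝ) = A * (ε / (k + 1)) ^ 2 := by simp only [hA]; field_simp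
          _ ≤ m * (ε / (k + 1)) ^ 2 := by gcongr) ht k C le_rfl)
    have hkε : k * (ε / (k + 1)) ≤ ε := by
      rw [mul_div_assoc', div_le_iff₀ (by positivity)]
      nlinarith
    have hpow : 0 ≤ (1 - δ) ^ k := by positivity
    refine (add_le_add_right ((div_le_iff₀ (by positivity)).2 (hkey.trans
      (?_ : _ ≤ ((1 - δ) ^ k + ε) * (2 * N)))) _).trans_eq (by ring)
    have : 0 ≤ ((1 - δ) ^ k + ε) * N := by positivity
    have : ((1 - δ) ^ k + k * (ε / (k + 1))) * N ≤ ((1 - δ) ^ k + ε) * N := by gcongr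
    linarith

end XorLemma
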